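/- Let $\alpha\ge 0$, and let $(a_k)_{k\ge1}$ and $(b_k)_{k\ge1}$ be two independent centered stationary Gaussian processes with $\mathbb E[a_ka_l]=\mathbb E[b_kb_l]=\cos((k-l)\alpha)$ for all $k,l\ge1$. For $n\ge1$ set $$f_n(t)=\frac1{\sqrt n}\sum_{k=1}^n\bigl(a_k\cos(kt)+b_k\sin(kt)\bigr),\qquad t\in\mathbb R,$$ and, for a function $f$, let $\mathcal N(f,[0,2\pi])$ be the number of distinct zeros of $f$ in $[0,2\pi]$. (i) If $\alpha=0$, then almost surely, for all $n\ge1$, $\mathcal N(f_n,[0,2\pi])=2n$. (ii) If $\alpha\in\pi\mathbb Q$, then $\mathcal N(f_n,[0,2\pi])$ has a finite expectation for every $n\ge1$, and $$\lim_{n\to+\infty}\left|\frac{\mathbb E[\mathcal N(f_n,[0,2\pi])]}{n}-2\right|\mathbf 1_{n\alpha\in\pi\mathbb Z}=0 .$$ (iii) Suppose $\alpha=2\pi p/q$ with positive coprime integers $p,q$, and for $n\ge 1$ with $q\mid n$ set $$\widetilde f_n(t)=\sum_{k=1}^q a_k\cos\Bigl(kt+\frac{(n-q)t}2\Bigr)+b_k\sin\Bigl(kt+\frac{(n-q)t}2\Bigr).$$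 Then, almost surely, for every such $n$ and every $t$ with $\sin(qt/2)\ne0$, $$f_n(t)=\frac1{\sqrt n}\,\widetilde f_n(t)\,\frac{\sin(nt/2)}{\sin(qt/2)},$$ and $$\liminf_{\substack{n\to+\infty\\ q\mid n}}\frac1n\,\mathbb E\bigl[\mathcal N(\widetilde f_n,[0,2\pi])\bigr]\ge1 .$$ -/

import Mathlib

open MeasureTheory ProbabilityTheory Filter Topology
open scoped ENNReal

/-- `(X_k)_{k ≥ 1}` is a centered stationary Gaussian process with correlation function `ρ`, that is
`E[X_k] = 0` and `E[X_k X_{k+j}] = ρ j` for all `k ≥ 1` and `j ≥ 0`. The value `X 0` plays no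
role. -/
structure IsStationaryGaussian {Ω : Type*} [MeasurableSpace Ω] (ρ : ℕ → ℝ) (X : ℕ → Ω → ℝ)
    (P : Measure Ω) : Prop where
  gaussian : IsGaussianProcess (fun k : ℕ+ => X k) P
  mean_zero : ∀ k : ℕ, 1 ≤ k → ∫ ω, X k ω ∂P = 0
  correlation : ∀ k j : ℕ, 1 ≤ k → ∫ ω, X k ω * X (k + j) ω ∂P = ρ j

/-- `(a_k)_{k ≥ 1}` and `(b_k)_{k ≥ 1}` are independent centered stationary Gaussian processes with
the same correlation function `k ↦ cos (k α)`. -/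
structure IsCosineGaussianPair {Ω : Type*} [MeasurableSpace Ω] (α : ℝ) (a b : ℕ → Ω → ℝ)
    (P : Measure Ω) : Prop where
  left : IsStationaryGaussian (fun k : ℕ => Real.cos (k * α)) a P
  right : IsStationaryGaussian (fun k : ℕ => Real.cos (k * α)) b P
  indep : IndepFun (fun ω (k : ℕ+) => a k ω) (fun ω (k : ℕ+) => b k ω) P

/-- `f_n(t) = n^{-1/2} ∑_{k=1}^n (a_k cos (k t) + b_k sin (k t))`, for the realization `ω`. -/
noncomputable def randTrigPoly {Ω : Type*} (a b : ℕ → Ω → ℝ) (n : ℕ) (ω : Ω) (t : ℝ) : ℝ :=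
  1 / Real.sqrt n *
    ∑ k ∈ Finset.Icc 1 n, (a k ω * Real.cos (k * t) + b k ω * Real.sin (k * t))

/-- `f̃_n(t) = ∑_{k=1}^q (a_k cos (k t + (n - q) t / 2) + b_k sin (k t + (n - q) t / 2))`. -/
noncomputable def randTrigFactor {Ω : Type*} (a b : ℕ → Ω → ℝ) (q n : ℕ) (ω : Ω) (t : ℝ) : ℝ :=
  ∑ k ∈ Finset.Icc 1 q,
    (a k ω * Real.cos (k * t + ((n : ℝ) - q) * t / 2) +
      b k ω * Real.sin (k * t + ((n : ℝ) - q) * t / 2))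

/-- The number (possibly infinite) of distinct real zeros of `f` in `[0, 2π]`. -/
noncomputable def zeroCount (f : ℝ → ℝ) : ℕ∞ :=
  {t : ℝ | t ∈ Set.Icc 0 (2 * Real.pi) ∧ f t = 0}.encard

/-- The expected number of zeros in `[0, 2π]` of the random function `F`. -/
noncomputable def expectedZeros {Ω : Type*} [MeasurableSpace Ω] (P : Measure Ω)
    (F : Ω → ℝ → ℝ) : ℝ≥0∞ :=
  ∫⁻ ω, (zeroCount (F ω) : ℝ≥0∞) ∂P

/-! The covariance $\cos((k-l)\alpha)$ has rank at most two, so the coefficients $c_k=a_k-ib_k$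
almost surely satisfy the deterministic recurrence $c_{k+2}=2\cos\alpha\,c_{k+1}-c_k$, and
$c_{k+n}=\pm c_k$ as soon as $n\alpha\in\pi\mathbb Z$. Summing the recurrence
(`cos_sub_mul_trigSum`) gives $2(\cos t-\cos\alpha)\sum_{k\le n}c_ke^{ikt}=(c_1-c_0e^{it})(1\mp
e^{int})$. Pulling $e^{int/2}$ out of the last factor and taking real parts, $(\cos
t-\cos\alpha)\,\mathrm{Re}\sum_{k\le n}c_ke^{ikt}=S(t)H(t)$, where $S$ is $\sin(nt/2)$ or
$\cos(nt/2)$ and $H$ mixes only the frequencies $n/2$ and $n/2+1$.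

$S$ has at least $n$ zeros in $[0,2\pi]$. $H$ has at least $n-1$, because one frequency dominates
or, when the amplitudes agree, $H$ is a product of two sinusoids
(`le_encard_zeros_two_frequencies`). The zeros of $S$ are rational multiples of $\pi$, where
$H=\pm\mathrm{Im}(c_1-c_0e^{it})$ is a nondegenerate Gaussian unless $\cos t=\cos\alpha$; hence
almost surely $S$ and $H$ share no other zero. This bounds the count below by $2n-5$, while the
degree of an associated polynomial bounds it above by $2n+1$. Both bounds hold pathwise, so the
expectations follow with no density computation.

For $\alpha=2\pi p/q$ and $q\mid n$, $f_n$ and $\widetilde f_n$ involve the same $H$, with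
$\sin(nt/2)$ and $\sin(qt/2)$ in front; this yields the factorization, and the zeros of $H$ yield
the liminf. -/

/-! ### Zeros of sinusoids and of two-frequency sums -/

theorem natCast_le_encard_of_injOn {β : Type*} {s : Set β} (f : ℕ → β) (k : ℕ)
    (hm : ∀ i < k, f i ∈ s) (hinj : ∀ i < k, ∀ j < k, f i = f j → i = j) :
    (k : ℕ∞) ≤ s.encard := by
  have h1 : Set.InjOn f (Set.Iio k) := fun i hi j hj h => hinj i hi j hj h
  have h2 : f '' Set.Iio k ⊆ s := by
    rintro _ ⟨i, hi, rfl⟩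
    exact hm i hi
  have h3 := Set.encard_le_encard h2
  rw [h1.encard_image] at h3
  have h4 : (Set.Iio k).encard = k := by
    rw [← Finset.coe_Iio, Set.encard_coe_eq_coe_finsetCard]
    simp
  rwa [h4] at h3

/-- A cosine of frequency `m` perturbed by a smaller continuous function has at least `2m - 1` zeros
in `[0, 2π]`. -/
theorem le_encard_zeros_cos_add {R m φ : ℝ} {M : ℕ} {r : ℝ → ℝ} (hM : 2 * m = M) (hM1 : 1 ≤ M)
    (hr : Continuous r) (hrR : ∀ t, |r t| < R) :
    (M : ℕ∞) ≤ {t : ℝ | t ∈ Set.Icc 0 (2 * Real.pi) ∧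
      R * Real.cos (m * t + φ) + r t = 0}.encard + 1 := by
  have hπ := Real.pi_pos
  have hm : 0 < m := by
    have : (1 : ℝ) ≤ M := by exact_mod_cast hM1
    linarith
  set g : ℝ → ℝ := fun t => R * Real.cos (m * t + φ) + r t with hg
  have hgc : Continuous g := by fun_prop
  -- The points `T i` are the successive extrema of the cosine from the first one in $[0,\infty)$.
  -- Since $|r|<R$, the sum keeps the sign of the cosine there, so it vanishes between consecutive
  -- extrema.
  set j₀ : ℤ := ⌈φ / Real.pi⌉ with hj₀
  set T : ℕ → ℝ := fun i => (Real.pi * (j₀ + i) - φ) / m with hT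
  have hTm : ∀ i, m * T i + φ = Real.pi * (j₀ + i) := by
    intro i
    simp only [hT]
    field_simp
    ring
  have hsign : ∀ i, g (T i) = R * (-1) ^ (j₀ + i) + r (T i) := by
    intro i
    simp only [hg]
    rw [hTm, show Real.pi * ((j₀ : ℝ) + i) = ((j₀ + i : ℤ) : ℝ) * Real.pi by push_cast; ring,
      Real.cos_int_mul_pi]
  have hlt : ∀ i, T i < T (i + 1) := by
    intro i
    simp only [hT]
    push_cast
    gcongr
    linarith
  have hzero : ∀ i, ∃ z ∈ Set.Ioo (T i) (T (i + 1)), g z = 0 := by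
    intro i
    have h0 := abs_lt.1 (hrR (T i))
    have h1 := abs_lt.1 (hrR (T (i + 1)))
    have e0 := hsign i
    have e1 := hsign (i + 1)
    push_cast at e1
    rw [← add_assoc, zpow_add_one₀ (by norm_num)] at e1
    rcases Int.even_or_odd (j₀ + i) with he | ho
    · rw [he.neg_one_zpow] at e0 e1
      exact intermediate_value_Ioo' (hlt i).le hgc.continuousOn ⟨by linarith, by linarith⟩
    · rw [ho.neg_one_zpow] at e0 e1
      exact intermediate_value_Ioo (hlt i).le hgc.continuousOn ⟨by linarith, by linarith⟩
  choose z hz hz0 using hzero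
  have hb : ∀ i : ℕ, (j₀ + i : ℝ) < (m * z i + φ) / Real.pi ∧
      (m * z i + φ) / Real.pi < j₀ + i + 1 := by
    intro i
    have h1 := mul_lt_mul_of_pos_left (hz i).1 hm
    have h2 := mul_lt_mul_of_pos_left (hz i).2 hm
    have h3 := hTm i
    have h4 := hTm (i + 1)
    push_cast at h4
    rw [lt_div_iff₀ hπ, div_lt_iff₀ hπ]
    constructor <;> linarith
  -- Whatever the phase, $[0,2\pi]$ contains the $M$ extrema `T 0`, …, `T (M - 1)`, hence $M-1$
  -- gaps.
  obtain ⟨K, rfl⟩ : ∃ K, M = K + 1 := ⟨M - 1, by omega⟩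
  push_cast
  gcongr
  refine natCast_le_encard_of_injOn z K (fun i hi => ⟨⟨?_, ?_⟩, hz0 i⟩) ?_
  · refine le_trans ?_ (hz i).1.le
    apply div_nonneg _ hm.le
    have h1 : φ / Real.pi ≤ j₀ := Int.le_ceil _
    rw [div_le_iff₀ hπ] at h1
    have : 0 ≤ Real.pi * i := by positivity
    linarith
  · refine (hz i).2.le.trans ?_
    have h1 : (j₀ : ℝ) < φ / Real.pi + 1 := Int.ceil_lt_add_one _
    rw [← sub_lt_iff_lt_add, lt_div_iff₀ hπ] at h1
    rw [show T (i + 1) = (Real.pi * (j₀ + (i + 1 : ℕ)) - φ) / m from rfl, div_le_iff₀ hm]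
    have h2 : ((i + 1 : ℕ) : ℝ) ≤ K := by exact_mod_cast hi
    have h3 := mul_le_mul_of_nonneg_left h2 hπ.le
    push_cast at *
    nlinarith
  · intro i _ j _ hij
    have h1 := hb i
    have h2 := hb j
    rw [← hij] at h2
    have h3 : (i : ℝ) < j + 1 := by linarith
    have h4 : (j : ℝ) < i + 1 := by linarith
    norm_cast at h3 h4
    omega

/-- A cosine whose frequency is half an integer `M` and that does not vanish at `0` has at least `M`
zeros in `(0, 2π)`. -/
theorem le_encard_zeros_cos {m φ : ℝ} {M : ℕ} (hM : 2 * m = M) (hM1 : 1 ≤ M)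
    (h0 : Real.cos φ ≠ 0) :
    (M : ℕ∞) ≤ {t : ℝ | t ∈ Set.Ioo 0 (2 * Real.pi) ∧ Real.cos (m * t + φ) = 0}.encard := by
  have hπ := Real.pi_pos
  have hm : 0 < m := by
    have : (1 : ℝ) ≤ M := by exact_mod_cast hM1
    linarith
  set x : ℝ := φ / Real.pi - 1 / 2 with hx
  have hφ : φ = (x + 1 / 2) * Real.pi := by
    rw [hx]; field_simp; ring
  set j₀ : ℤ := ⌈x⌉ with hj₀
  -- The zeros correspond to the integers $j$ with $x<j<x+M$. As $\cos\varphi\ne0$ makes $x$ a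
  -- non-integer, there are exactly $M$ of them, and none sits at an endpoint.
  have hne : x ≠ j₀ := by
    intro h
    apply h0
    rw [Real.cos_eq_zero_iff]
    exact ⟨j₀, by rw [hφ, h]; ring⟩
  have h1 : x < j₀ := lt_of_le_of_ne (Int.le_ceil _) hne
  have h2 : (j₀ : ℝ) < x + 1 := Int.ceil_lt_add_one _
  have hz : ∀ i : ℕ, m * ((j₀ + i - x) * Real.pi / m) + φ = (2 * (j₀ + i : ℤ) + 1) * Real.pi / 2 := by
    intro i
    rw [hφ]
    push_cast
    field_simp
    ring
  refine natCast_le_encard_of_injOn (fun i : ℕ => (j₀ + i - x) * Real.pi / m) M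
    (fun i hi => ⟨⟨?_, ?_⟩, ?_⟩) ?_
  · apply div_pos _ hm
    apply mul_pos _ hπ
    have : (0 : ℝ) ≤ i := by positivity
    linarith
  · rw [div_lt_iff₀ hm]
    have h3 : (i + 1 : ℝ) ≤ M := by exact_mod_cast hi
    nlinarith
  · rw [Real.cos_eq_zero_iff]
    exact ⟨j₀ + i, hz i⟩
  · intro i _ j _ hij
    have hij' : ((j₀ + i - x) * Real.pi / m) = ((j₀ + j - x) * Real.pi / m) := hij
    rw [div_left_inj' hm.ne', mul_left_inj' hπ.ne'] at hij'
    have : (i : ℝ) = j := by linarith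
    exact_mod_cast this

theorem Complex.re_mul_exp_mul_I (w : ℂ) (x : ℝ) :
    (w * Complex.exp (x * Complex.I)).re = ‖w‖ * Real.cos (x + w.arg) := by
  conv_lhs => rw [← Complex.norm_mul_exp_arg_mul_I w]
  rw [mul_assoc, ← Complex.exp_add, ← add_mul, ← Complex.ofReal_add, Complex.re_ofReal_mul,
    Complex.exp_ofReal_mul_I_re, add_comm x]

/-- A nonzero real combination of the frequencies `n / 2` and `n / 2 + 1` has at least `n - 1` zeros
in `[0, 2π]`. -/
theorem le_encard_zeros_two_frequencies {n : ℕ} (hn : 1 ≤ n) {d₀ d₁ : ℂ} (hd : d₁ ≠ 0) :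
    (n : ℕ∞) ≤ {t : ℝ | t ∈ Set.Icc 0 (2 * Real.pi) ∧
      ((d₁ - d₀ * Complex.exp (t * Complex.I)) *
        Complex.exp ((n / 2 * t : ℝ) * Complex.I)).re = 0}.encard + 1 := by
  have key : ∀ t : ℝ, ((d₁ - d₀ * Complex.exp (t * Complex.I)) *
      Complex.exp ((n / 2 * t : ℝ) * Complex.I)).re =
      ‖d₁‖ * Real.cos (n / 2 * t + d₁.arg) +
        ‖-d₀‖ * Real.cos ((n / 2 + 1) * t + (-d₀).arg) := by
    intro t
    rw [← Complex.re_mul_exp_mul_I, show (n / 2 + 1 : ℝ) * t + (-d₀).arg =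
      ((n / 2 + 1 : ℝ) * t) + (-d₀).arg by ring, ← Complex.re_mul_exp_mul_I, ← Complex.add_re]
    congr 1
    rw [sub_mul, sub_eq_add_neg, neg_mul, mul_assoc d₀, ← Complex.exp_add]
    congr 4
    push_cast
    ring
  have hlt : ∀ {x y θ : ℝ}, |x| < y → |x * Real.cos θ| < y := by
    intro x y θ h
    rw [abs_mul]
    exact (mul_le_of_le_one_right (abs_nonneg _) (Real.abs_cos_le_one _)).trans_lt h
  -- The larger amplitude dictates the zeros. In the balanced case $d_0=d_1e^{i\theta}$, the
  -- identity $1-e^{ix}=-2i\sin(x/2)e^{ix/2}$ with $x=t+\theta$ splits off a sine and leaves a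
  -- single cosine of frequency $(n+1)/2$.
  rcases lt_trichotomy ‖d₀‖ ‖d₁‖ with h | h | h
  · simp_rw [key]
    refine le_encard_zeros_cos_add (by ring) hn (by fun_prop) fun t => hlt ?_
    rwa [norm_neg, abs_norm]
  · have hd0 : d₀ ≠ 0 := norm_ne_zero_iff.1 (h ▸ norm_ne_zero_iff.2 hd)
    set θ : ℝ := (d₀ / d₁).arg with hθ
    have hw : d₀ = d₁ * Complex.exp (θ * Complex.I) := by
      have := Complex.norm_mul_exp_arg_mul_I (d₀ / d₁)
      rw [norm_div, h, div_self (norm_ne_zero_iff.2 hd), Complex.ofReal_one, one_mul] at this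
      rw [hθ, this]
      field_simp
    set u : ℂ := -Complex.I * d₁ * Complex.exp ((θ / 2 : ℝ) * Complex.I) with hu
    have key2 : ∀ t : ℝ, ((d₁ - d₀ * Complex.exp (t * Complex.I)) *
        Complex.exp ((n / 2 * t : ℝ) * Complex.I)).re =
        2 * Real.sin ((t + θ) / 2) * (‖u‖ * Real.cos ((n + 1) / 2 * t + u.arg)) := by
      intro t
      rw [← Complex.re_mul_exp_mul_I, ← Complex.re_ofReal_mul]
      congr 1
      push_cast
      rw [Complex.sin, hu, hw]
      have e1 : Complex.exp (((n + 1) / 2 * t : ℂ) * Complex.I) =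
          Complex.exp ((n / 2 * t : ℝ) * Complex.I) * Complex.exp ((t / 2 : ℝ) * Complex.I) := by
        rw [← Complex.exp_add]; congr 1; push_cast; ring
      have e2 : Complex.exp ((t : ℂ) * Complex.I) =
          Complex.exp ((t / 2 : ℝ) * Complex.I) * Complex.exp ((t / 2 : ℝ) * Complex.I) := by
        rw [← Complex.exp_add]; congr 1; push_cast; ring
      have e3 : Complex.exp ((θ : ℂ) * Complex.I) =
          Complex.exp ((θ / 2 : ℝ) * Complex.I) * Complex.exp ((θ / 2 : ℝ) * Complex.I) := by
        rw [← Complex.exp_add]; congr 1; push_cast; ring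
      have e4 : Complex.exp (((t : ℂ) + θ) / 2 * Complex.I) =
          Complex.exp ((t / 2 : ℝ) * Complex.I) * Complex.exp ((θ / 2 : ℝ) * Complex.I) := by
        rw [← Complex.exp_add]; congr 1; push_cast; ring
      have e5 : Complex.exp (-(((t : ℂ) + θ) / 2) * Complex.I) =
          (Complex.exp ((t / 2 : ℝ) * Complex.I) * Complex.exp ((θ / 2 : ℝ) * Complex.I))⁻¹ := by
        rw [← e4, ← Complex.exp_neg]; congr 1; ring
      have e6 : Complex.exp (((n : ℂ) / 2 * t) * Complex.I) =
          Complex.exp ((n / 2 * t : ℝ) * Complex.I) := by push_cast; rfl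
      rw [e6, e5, e4, e3, e2, e1]
      have h1 := Complex.exp_ne_zero ((t / 2 : ℝ) * Complex.I)
      have h2 := Complex.exp_ne_zero ((θ / 2 : ℝ) * Complex.I)
      generalize Complex.exp ((t / 2 : ℝ) * Complex.I) = x at *
      generalize Complex.exp ((θ / 2 : ℝ) * Complex.I) = y at *
      have h3 := Complex.exp_ne_zero ((n / 2 * t : ℝ) * Complex.I)
      generalize Complex.exp ((n / 2 * t : ℝ) * Complex.I) = w at *
      field_simp
      linear_combination (1 - x ^ 2 * y ^ 2) * Complex.I_sq
    have hu0 : u ≠ 0 := by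
      rw [hu]
      exact mul_ne_zero (mul_ne_zero (neg_ne_zero.2 Complex.I_ne_zero) hd) (Complex.exp_ne_zero _)
    have := le_encard_zeros_cos_add (R := ‖u‖) (m := (n + 1) / 2) (φ := u.arg) (M := n + 1)
      (r := fun _ => 0) (by push_cast; ring) (by omega) continuous_const
      (fun t => by rw [abs_zero]; exact norm_pos_iff.2 hu0)
    refine (le_trans (by exact_mod_cast Nat.le_succ n) this).trans
      (add_le_add_left (Set.encard_le_encard ?_) 1)
    rintro t ⟨ht, h⟩
    refine ⟨ht, ?_⟩
    rw [key2]
    rw [add_zero] at h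
    rw [h, mul_zero]
  · simp_rw [key, add_comm (‖d₁‖ * _)]
    have := le_encard_zeros_cos_add (R := ‖-d₀‖) (m := n / 2 + 1) (φ := (-d₀).arg) (M := n + 2)
      (r := fun t => ‖d₁‖ * Real.cos (n / 2 * t + d₁.arg)) (by push_cast; ring) (by omega)
      (by fun_prop) fun t => hlt (by rwa [norm_neg, abs_norm])
    exact (le_trans (by exact_mod_cast (by omega : n ≤ n + 2)) this)

/-! ### Closed form of trigonometric sums with recurrent coefficients -/

/-- The complex trigonometric sum `∑_{k=1}^n c_k e^{ikt}`. -/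
noncomputable def trigSum (c : ℕ → ℂ) (n : ℕ) (t : ℝ) : ℂ :=
  ∑ k ∈ Finset.Icc 1 n, c k * Complex.exp (t * Complex.I) ^ k

/-- The value at `0` of the extension of `c` by the recurrence `c (k + 2) = 2 cos α c (k + 1) - c k`. -/
noncomputable def zerothCoeff (α : ℝ) (c : ℕ → ℂ) : ℂ := 2 * Real.cos α * c 1 - c 2

/-- The almost sure properties of the complex coefficients `c_k = a_k - i b_k`. -/
structure IsGenericCosineSeq (α : ℝ) (c : ℕ → ℂ) : Prop where
  recurrence : ∀ k, 1 ≤ k → c (k + 2) = 2 * Real.cos α * c (k + 1) - c k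
  periodic : ∀ n k : ℕ, 1 ≤ k → Real.sin (n * α) = 0 → c (k + n) = Real.cos (n * α) * c k
  re_ne_zero : (c 1).re ≠ 0
  im_ne_zero : ∀ r : ℚ, Real.cos (r * Real.pi) ≠ Real.cos α →
    (c 1 - zerothCoeff α c * Complex.exp ((r * Real.pi : ℝ) * Complex.I)).im ≠ 0

theorem IsGenericCosineSeq.ne_zero {α : ℝ} {c : ℕ → ℂ} (h : IsGenericCosineSeq α c) :
    c 1 ≠ 0 := fun h0 => h.re_ne_zero (by rw [h0, Complex.zero_re])

/-- Multiplication by the characteristic polynomial telescopes: the recurrence kills every interior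
coefficient and only boundary terms survive. The last one is $c_nz^{n+2}$, with $c_n$ extrapolated
backwards so that the formula also holds at $n=0$ whatever the value `c 0`. -/
theorem sum_mul_of_recurrence {R : Type*} [CommRing R] {c : ℕ → R} {γ : R}
    (h : ∀ k, 1 ≤ k → c (k + 2) = 2 * γ * c (k + 1) - c k) (z : R) (n : ℕ) :
    (1 - 2 * γ * z + z ^ 2) * ∑ k ∈ Finset.Icc 1 n, c k * z ^ k =
      c 1 * z - (2 * γ * c 1 - c 2) * z ^ 2 - c (n + 1) * z ^ (n + 1) +
        (2 * γ * c (n + 1) - c (n + 2)) * z ^ (n + 2) := by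
  induction n with
  | zero => simp
  | succ n ih =>
    rw [Finset.sum_Icc_succ_top (by omega), mul_add, ih]
    linear_combination (z ^ (n + 3)) * (h (n + 1) (by omega))

/-- On the unit circle $1-2\cos\alpha\,z+z^2=2z(\cos t-\cos\alpha)$, and periodicity up to sign
turns the boundary terms at $n$ into a multiple of those at $0$. -/
theorem cos_sub_mul_trigSum {α : ℝ} {c : ℕ → ℂ} (h : IsGenericCosineSeq α c) {n : ℕ}
    (hn : Real.sin (n * α) = 0) (t : ℝ) :
    2 * ((Real.cos t - Real.cos α : ℝ) : ℂ) * trigSum c n t =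
      (c 1 - zerothCoeff α c * Complex.exp (t * Complex.I)) *
        (1 - Real.cos (n * α) * Complex.exp (t * Complex.I) ^ n) := by
  have h1 := sum_mul_of_recurrence h.recurrence (Complex.exp (t * Complex.I)) n
  have e1 := h.periodic n 1 le_rfl hn
  have e2 := h.periodic n 2 one_le_two hn
  rw [add_comm n 1, add_comm n 2, e1, e2] at h1
  have hz : Complex.exp (t * Complex.I) ≠ 0 := Complex.exp_ne_zero _
  have hc : (2 * Real.cos t : ℂ) * Complex.exp (t * Complex.I) =
      1 + Complex.exp (t * Complex.I) ^ 2 := by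
    rw [Complex.ofReal_cos, Complex.two_cos, neg_mul, Complex.exp_neg]
    field_simp
    ring
  apply mul_left_cancel₀ hz
  rw [trigSum, zerothCoeff]
  push_cast at h1 hc ⊢
  linear_combination h1 + (∑ k ∈ Finset.Icc 1 n, c k * Complex.exp (t * Complex.I) ^ k) * hc

theorem exp_pow_eq_exp_half_sq (n : ℕ) (t : ℝ) :
    Complex.exp (t * Complex.I) ^ n = Complex.exp ((n / 2 * t : ℝ) * Complex.I) ^ 2 := by
  rw [← Complex.exp_nat_mul, ← Complex.exp_nat_mul]
  congr 1
  push_cast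
  ring

theorem exp_ofReal_mul_I (x : ℝ) :
    Complex.exp (x * Complex.I) = (Real.cos x : ℂ) + Real.sin x * Complex.I := by
  rw [Complex.exp_mul_I, Complex.ofReal_cos, Complex.ofReal_sin]

theorem one_sub_exp_sq (x : ℝ) : 1 - Complex.exp (x * Complex.I) ^ 2 =
    2 * (Real.sin x : ℂ) * (-Complex.I * Complex.exp (x * Complex.I)) := by
  have h : ((Real.sin x : ℂ)) ^ 2 + (Real.cos x : ℂ) ^ 2 = 1 := by
    exact_mod_cast Real.sin_sq_add_cos_sq x
  rw [exp_ofReal_mul_I]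
  linear_combination -h + (Real.sin x : ℂ) ^ 2 * Complex.I_sq

theorem one_add_exp_sq (x : ℝ) : 1 + Complex.exp (x * Complex.I) ^ 2 =
    2 * (Real.cos x : ℂ) * Complex.exp (x * Complex.I) := by
  have h : ((Real.sin x : ℂ)) ^ 2 + (Real.cos x : ℂ) ^ 2 = 1 := by
    exact_mod_cast Real.sin_sq_add_cos_sq x
  rw [exp_ofReal_mul_I]
  linear_combination -h + (Real.sin x : ℂ) ^ 2 * Complex.I_sq

/-- The half-angle form of $1-e^{iqt}$ splits off $\sin(qt/2)$. The free phase $s$ lets one identity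
serve both $f_n$ ($s=0$) and $\widetilde f_n$ ($s=(n-q)t/2$). -/
theorem cos_sub_mul_trigSum_of_eq_one {α : ℝ} {c : ℕ → ℂ} (h : IsGenericCosineSeq α c) {q : ℕ}
    (hs : Real.sin (q * α) = 0) (hc : Real.cos (q * α) = 1) (s t : ℝ) :
    (Real.cos t - Real.cos α) * (Complex.exp (s * Complex.I) * trigSum c q t).re =
      Real.sin (q / 2 * t) * ((-Complex.I * c 1 - -Complex.I * zerothCoeff α c *
        Complex.exp (t * Complex.I)) * Complex.exp ((s + q / 2 * t : ℝ) * Complex.I)).re := by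
  rw [← Complex.re_ofReal_mul, ← Complex.re_ofReal_mul]
  congr 1
  have h1 := cos_sub_mul_trigSum h hs t
  rw [hc, exp_pow_eq_exp_half_sq, Complex.ofReal_one, one_mul, one_sub_exp_sq] at h1
  have h2 : Complex.exp ((s + q / 2 * t : ℝ) * Complex.I) =
      Complex.exp (s * Complex.I) * Complex.exp ((q / 2 * t : ℝ) * Complex.I) := by
    rw [← Complex.exp_add]; push_cast; ring_nf
  rw [h2]
  linear_combination (Complex.exp (s * Complex.I) / 2) * h1

theorem cos_sub_mul_trigSum_of_eq_neg_one {α : ℝ} {c : ℕ → ℂ} (h : IsGenericCosineSeq α c) {n : ℕ}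
    (hs : Real.sin (n * α) = 0) (hc : Real.cos (n * α) = -1) (t : ℝ) :
    (Real.cos t - Real.cos α) * (trigSum c n t).re =
      Real.cos (n / 2 * t) * ((c 1 - zerothCoeff α c *
        Complex.exp (t * Complex.I)) * Complex.exp ((n / 2 * t : ℝ) * Complex.I)).re := by
  rw [← Complex.re_ofReal_mul, ← Complex.re_ofReal_mul]
  congr 1
  have h1 := cos_sub_mul_trigSum h hs t
  rw [hc, exp_pow_eq_exp_half_sq, Complex.ofReal_neg, Complex.ofReal_one, neg_one_mul,
    sub_neg_eq_add, one_add_exp_sq] at h1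
  linear_combination (1 / 2) * h1

/-! ### Common zeros of the two factors and the lower bound -/

theorem encard_cos_eq_le (γ : ℝ) :
    {t : ℝ | t ∈ Set.Icc 0 (2 * Real.pi) ∧ Real.cos t = γ}.encard ≤ 2 := by
  refine (Set.encard_le_encard (t := {Real.arccos γ, 2 * Real.pi - Real.arccos γ}) ?_).trans
    ((Set.encard_insert_le _ _).trans (by rw [Set.encard_singleton]; norm_num))
  rintro t ⟨⟨h0, h1⟩, rfl⟩
  rcases le_total t Real.pi with h | h
  · left
    rw [Real.arccos_cos h0 h]
  · right
    rw [← Real.cos_two_pi_sub, Real.arccos_cos (by linarith) (by linarith)]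
    simp

theorem exists_rat_of_sin_half {n : ℕ} (hn : 1 ≤ n) {t : ℝ} (h : Real.sin (n / 2 * t) = 0) :
    ∃ r : ℚ, t = r * Real.pi := by
  obtain ⟨k, hk⟩ := Real.sin_eq_zero_iff.1 h
  have hn' : (n : ℝ) ≠ 0 := by positivity
  refine ⟨2 * k / n, ?_⟩
  push_cast
  field_simp
  linarith

theorem exists_rat_of_cos_half {n : ℕ} (hn : 1 ≤ n) {t : ℝ} (h : Real.cos (n / 2 * t) = 0) :
    ∃ r : ℚ, t = r * Real.pi := by
  obtain ⟨k, hk⟩ := Real.cos_eq_zero_iff.1 h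
  have hn' : (n : ℝ) ≠ 0 := by positivity
  refine ⟨(2 * k + 1) / n, ?_⟩
  push_cast
  field_simp
  linarith

theorem le_encard_sin_half {n : ℕ} (hn : 1 ≤ n) :
    (n : ℕ∞) ≤ {t : ℝ | t ∈ Set.Ico 0 (2 * Real.pi) ∧ Real.sin (n / 2 * t) = 0}.encard := by
  have hn' : (0 : ℝ) < n := by positivity
  have hπ := Real.pi_pos
  refine natCast_le_encard_of_injOn (fun i => 2 * Real.pi * i / n) n
    (fun i hi => ⟨⟨by positivity, ?_⟩, ?_⟩) ?_
  · have : (i : ℝ) < n := by exact_mod_cast hi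
    rw [div_lt_iff₀ hn']
    gcongr
  · rw [show (n / 2 * (2 * Real.pi * i / n) : ℝ) = i * Real.pi by field_simp]
    exact Real.sin_nat_mul_pi i
  · intro i _ j _ hij
    have hij' : 2 * Real.pi * (i : ℝ) / n = 2 * Real.pi * (j : ℝ) / n := hij
    rw [div_left_inj' hn'.ne', mul_right_inj' (by positivity)] at hij'
    exact_mod_cast hij'

theorem le_encard_cos_half {n : ℕ} (hn : 1 ≤ n) :
    (n : ℕ∞) ≤ {t : ℝ | t ∈ Set.Ioo 0 (2 * Real.pi) ∧ Real.cos (n / 2 * t) = 0}.encard := by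
  simpa using le_encard_zeros_cos (m := n / 2) (φ := 0) (M := n) (by ring) hn (by simp)

/-- Off the zeros of `cos t - cos α`, the two factors of `∑ c_k e^{ikt}` have no common zero. -/
theorem IsGenericCosineSeq.cos_eq_of_im_eq_zero {α : ℝ} {c : ℕ → ℂ} (h : IsGenericCosineSeq α c)
    {t : ℝ} (ht : ∃ r : ℚ, t = r * Real.pi)
    (h0 : (c 1 - zerothCoeff α c * Complex.exp (t * Complex.I)).im = 0) :
    Real.cos t = Real.cos α := by
  obtain ⟨r, rfl⟩ := ht
  by_contra hne
  exact h.im_ne_zero r hne h0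

/-- Where $\sin(nt/2)=0$, $e^{int/2}=\pm1$, so the other factor reduces to
$\pm\mathrm{Im}(c_1-c_0e^{it})$. In the cosine version below, $e^{int/2}=\pm i$ plays the role of
the factor $-i$. -/
theorem IsGenericCosineSeq.cos_eq_of_sin_half {α : ℝ} {c : ℕ → ℂ} (h : IsGenericCosineSeq α c)
    {n : ℕ} (hn : 1 ≤ n) {t : ℝ} (hs : Real.sin (n / 2 * t) = 0)
    (h0 : ((-Complex.I * c 1 - -Complex.I * zerothCoeff α c * Complex.exp (t * Complex.I)) *
      Complex.exp ((n / 2 * t : ℝ) * Complex.I)).re = 0) :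
    Real.cos t = Real.cos α := by
  refine h.cos_eq_of_im_eq_zero (exists_rat_of_sin_half hn hs) ?_
  have hc : Real.cos (n / 2 * t) ≠ 0 := by
    intro hc
    have := Real.sin_sq_add_cos_sq (n / 2 * t)
    rw [hs, hc] at this
    norm_num at this
  rw [exp_ofReal_mul_I (n / 2 * t), hs, mul_assoc, ← mul_sub] at h0
  generalize c 1 - _ = w at *
  simp [-Complex.ofReal_cos, -Complex.ofReal_sin] at h0
  exact h0.resolve_right hc

theorem IsGenericCosineSeq.cos_eq_of_cos_half {α : ℝ} {c : ℕ → ℂ} (h : IsGenericCosineSeq α c)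
    {n : ℕ} (hn : 1 ≤ n) {t : ℝ} (hc : Real.cos (n / 2 * t) = 0)
    (h0 : ((c 1 - zerothCoeff α c * Complex.exp (t * Complex.I)) *
      Complex.exp ((n / 2 * t : ℝ) * Complex.I)).re = 0) :
    Real.cos t = Real.cos α := by
  refine h.cos_eq_of_im_eq_zero (exists_rat_of_cos_half hn hc) ?_
  have hs : Real.sin (n / 2 * t) ≠ 0 := by
    intro hs
    have := Real.sin_sq_add_cos_sq (n / 2 * t)
    rw [hs, hc] at this
    norm_num at this
  rw [exp_ofReal_mul_I (n / 2 * t), hc] at h0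
  generalize c 1 - _ = w at *
  simp [-Complex.ofReal_cos, -Complex.ofReal_sin] at h0
  exact h0.resolve_right hs

/-- Counting the zeros of a function that factors as `S * H` away from few exceptional points. -/
theorem le_encard_zeros_of_mul_eq {I : Set ℝ} {f p S H : ℝ → ℝ} {k l m : ℕ∞}
    (hf : ∀ t, p t * f t = S t * H t) (hp : {t | t ∈ I ∧ p t = 0}.encard ≤ m)
    (hS : k ≤ {t | t ∈ I ∧ S t = 0}.encard) (hH : l ≤ {t | t ∈ I ∧ H t = 0}.encard)
    (hSH : ∀ t, S t = 0 → H t = 0 → p t = 0) :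
    k + l ≤ {t | t ∈ I ∧ f t = 0}.encard + m + m := by
  refine (add_le_add hS hH).trans ?_
  -- Zeros of $p$ are charged twice: once as zeros of $SH$ that need not be zeros of $f$, once as
  -- possible common zeros of $S$ and $H$.
  rw [← Set.encard_union_add_encard_inter]
  refine add_le_add ?_ ((Set.encard_le_encard ?_).trans hp)
  · refine (Set.encard_le_encard (t := {t | t ∈ I ∧ f t = 0} ∪ {t | t ∈ I ∧ p t = 0}) ?_).trans
      ((Set.encard_union_le _ _).trans (by gcongr))
    have key : ∀ t, S t * H t = 0 → f t = 0 ∨ p t = 0 := by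
      intro t ht
      rw [← hf, mul_eq_zero] at ht
      exact ht.symm
    rintro t (⟨ht, h⟩ | ⟨ht, h⟩)
    · rcases key t (by rw [h, zero_mul]) with h' | h'
      exacts [Or.inl ⟨ht, h'⟩, Or.inr ⟨ht, h'⟩]
    · rcases key t (by rw [h, mul_zero]) with h' | h'
      exacts [Or.inl ⟨ht, h'⟩, Or.inr ⟨ht, h'⟩]
  · rintro t ⟨⟨ht, h1⟩, ⟨_, h2⟩⟩
    exact ⟨ht, hSH t h1 h2⟩

theorem encard_cos_sub_le (α : ℝ) :
    {t : ℝ | t ∈ Set.Icc 0 (2 * Real.pi) ∧ Real.cos t - Real.cos α = 0}.encard ≤ 2 := by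
  simp_rw [sub_eq_zero]
  exact encard_cos_eq_le _

/-- The loss of 5 is the one zero possibly missing from the two-frequency factor, plus twice the at
most two zeros of $\cos t-\cos\alpha$. -/
theorem IsGenericCosineSeq.le_zeroCount {α : ℝ} {c : ℕ → ℂ} (h : IsGenericCosineSeq α c)
    {n : ℕ} (hn : 1 ≤ n) (hs : Real.sin (n * α) = 0) :
    ((2 * n : ℕ) : ℕ∞) ≤ zeroCount (fun t => (trigSum c n t).re) + 5 := by
  have hc : Real.cos (n * α) = 1 ∨ Real.cos (n * α) = -1 := by
    have := Real.sin_sq_add_cos_sq (n * α)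
    rw [hs] at this
    exact mul_self_eq_one_iff.1 (by linarith)
  have key : ∃ S H : ℝ → ℝ,
      (∀ t, (Real.cos t - Real.cos α) * (trigSum c n t).re = S t * H t) ∧
      (n : ℕ∞) ≤ {t | t ∈ Set.Icc 0 (2 * Real.pi) ∧ S t = 0}.encard ∧
      (n : ℕ∞) ≤ {t | t ∈ Set.Icc 0 (2 * Real.pi) ∧ H t = 0}.encard + 1 ∧
      (∀ t, S t = 0 → H t = 0 → Real.cos t - Real.cos α = 0) := by
    rcases hc with hc | hc
    · refine ⟨_, _, fun t => ?_, (le_encard_sin_half hn).trans (Set.encard_le_encard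
        fun t ht => ⟨Set.Ico_subset_Icc_self ht.1, ht.2⟩),
        le_encard_zeros_two_frequencies (d₀ := -Complex.I * zerothCoeff α c) hn
          (mul_ne_zero (neg_ne_zero.2 Complex.I_ne_zero) h.ne_zero),
        fun t h1 h2 => sub_eq_zero.2 (h.cos_eq_of_sin_half hn h1 h2)⟩
      simpa using cos_sub_mul_trigSum_of_eq_one h hs hc 0 t
    · exact ⟨_, _, cos_sub_mul_trigSum_of_eq_neg_one h hs hc, (le_encard_cos_half hn).trans
        (Set.encard_le_encard fun t ht => ⟨Set.Ioo_subset_Icc_self ht.1, ht.2⟩),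
        le_encard_zeros_two_frequencies hn h.ne_zero,
        fun t h1 h2 => sub_eq_zero.2 (h.cos_eq_of_cos_half hn h1 h2)⟩
  obtain ⟨S, H, hf, hS, hH, hSH⟩ := key
  have h1 := le_encard_zeros_of_mul_eq hf (encard_cos_sub_le α) hS le_rfl hSH
  calc ((2 * n : ℕ) : ℕ∞) = n + n := by push_cast; ring
    _ ≤ n + ({t | t ∈ Set.Icc 0 (2 * Real.pi) ∧ H t = 0}.encard + 1) := by gcongr
    _ ≤ (zeroCount (fun t => (trigSum c n t).re) + 2 + 2) + 1 := by
      rw [← add_assoc]; exact add_le_add h1 le_rfl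
    _ = _ := by rw [add_assoc, add_assoc]; norm_num

/-- Only the two-frequency factor, of base frequency $n/2$, is used: its $n-1$ zeros are zeros of
the sum, apart from at most two with $\cos t=\cos\alpha$. -/
theorem IsGenericCosineSeq.le_zeroCount_factor {α : ℝ} {c : ℕ → ℂ} (h : IsGenericCosineSeq α c)
    {q n : ℕ} (hn : 1 ≤ n) (hs : Real.sin (q * α) = 0) (hc : Real.cos (q * α) = 1) :
    (n : ℕ∞) ≤ zeroCount (fun t => (Complex.exp (((n - q) * t / 2 : ℝ) * Complex.I) *
      trigSum c q t).re) + 3 := by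
  have h1 := le_encard_zeros_two_frequencies (d₀ := -Complex.I * zerothCoeff α c) hn
    (mul_ne_zero (neg_ne_zero.2 Complex.I_ne_zero) h.ne_zero)
  refine h1.trans ?_
  rw [show (3 : ℕ∞) = 2 + 1 by norm_num, ← add_assoc]
  gcongr
  refine (Set.encard_le_encard (t := _ ∪
    {t : ℝ | t ∈ Set.Icc 0 (2 * Real.pi) ∧ Real.cos t - Real.cos α = 0}) ?_).trans
    ((Set.encard_union_le _ _).trans (add_le_add le_rfl (encard_cos_sub_le α)))
  rintro t ⟨ht, h0⟩
  have h2 := cos_sub_mul_trigSum_of_eq_one h hs hc ((n - q) * t / 2) t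
  rw [show ((n - q) * t / 2 + q / 2 * t : ℝ) = n / 2 * t by ring, h0, mul_zero, mul_eq_zero] at h2
  exact h2.symm.imp (fun h => ⟨ht, h⟩) (fun h => ⟨ht, h⟩)

/-! ### Upper bound by the degree of a polynomial -/

theorem injOn_exp_mul_I :
    Set.InjOn (fun t : ℝ => Complex.exp (t * Complex.I)) (Set.Ico 0 (2 * Real.pi)) := by
  intro s hs t ht hst
  obtain ⟨k, hk⟩ := Complex.exp_eq_exp_iff_exists_int.1 hst
  have h1 : s = t + k * (2 * Real.pi) := by
    have := congrArg Complex.im hk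
    simpa using this
  have hπ := Real.pi_pos
  have h2 : (k : ℝ) < 1 := by
    by_contra! h
    nlinarith [hs.2, ht.1]
  have h3 : (-1 : ℝ) < k := by
    by_contra! h
    nlinarith [hs.1, ht.2]
  have h4 : k = 0 := by
    have h2' : k < 1 := by exact_mod_cast h2
    have h3' : -1 < k := by exact_mod_cast h3
    omega
  rw [h1, h4]
  simp

open Polynomial in
/-- The polynomial `P` of degree at most `2n` with
`P(e^{it}) = 2 e^{int} Re (∑_{k=1}^n c_k e^{ikt})`. -/
noncomputable def trigSumPoly (c : ℕ → ℂ) (n : ℕ) : ℂ[X] :=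
  ∑ k ∈ Finset.Icc 1 n, (C (c k) * X ^ (n + k) + C ((starRingEnd ℂ) (c k)) * X ^ (n - k))

theorem trigSumPoly_ne_zero {c : ℕ → ℂ} (hc : c 1 ≠ 0) {n : ℕ} (hn : 1 ≤ n) :
    trigSumPoly c n ≠ 0 := by
  intro h
  apply hc
  -- The coefficient of $X^{n+1}$ is exactly $c_1$: the exponents $n-k$ are too small, and $n+k=n+1$
  -- forces $k=1$.
  have h1 := congrArg (fun p => Polynomial.coeff p (n + 1)) h
  simp only [trigSumPoly, Polynomial.finsetSum_coeff, Polynomial.coeff_add,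
    Polynomial.coeff_C_mul, Polynomial.coeff_X_pow, Polynomial.coeff_zero] at h1
  rw [Finset.sum_eq_single 1] at h1
  · rw [if_pos rfl, if_neg (by omega)] at h1
    simpa using h1
  · intro k hk hk1
    rw [Finset.mem_Icc] at hk
    rw [if_neg (by omega), if_neg (by omega)]
    simp
  · intro h
    exact absurd (Finset.mem_Icc.2 ⟨le_rfl, hn⟩) h

theorem natDegree_trigSumPoly_le (c : ℕ → ℂ) (n : ℕ) : (trigSumPoly c n).natDegree ≤ 2 * n := by
  refine Polynomial.natDegree_sum_le_of_forall_le _ _ fun k hk => ?_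
  rw [Finset.mem_Icc] at hk
  refine Polynomial.natDegree_add_le_of_degree_le ?_ ?_
  · exact (Polynomial.natDegree_C_mul_X_pow_le _ _).trans (by omega)
  · exact (Polynomial.natDegree_C_mul_X_pow_le _ _).trans (by omega)

theorem eval_trigSumPoly (c : ℕ → ℂ) (n : ℕ) (t : ℝ) :
    (trigSumPoly c n).eval (Complex.exp (t * Complex.I)) =
      Complex.exp (t * Complex.I) ^ n * (2 * (trigSum c n t).re : ℝ) := by
  have h2 : ((2 * (trigSum c n t).re : ℝ) : ℂ) =
      trigSum c n t + (starRingEnd ℂ) (trigSum c n t) := by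
    rw [Complex.add_conj]
  have hz : (starRingEnd ℂ) (Complex.exp (t * Complex.I)) = (Complex.exp (t * Complex.I))⁻¹ := by
    rw [← Complex.exp_conj, ← Complex.exp_neg]
    simp
  have hz0 : Complex.exp (t * Complex.I) ≠ 0 := Complex.exp_ne_zero _
  rw [h2, trigSum, trigSumPoly, Polynomial.eval_finsetSum, map_sum, ← Finset.sum_add_distrib,
    Finset.mul_sum]
  refine Finset.sum_congr rfl fun k hk => ?_
  rw [Finset.mem_Icc] at hk
  simp only [Polynomial.eval_add, Polynomial.eval_mul, Polynomial.eval_C, Polynomial.eval_pow,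
    Polynomial.eval_X, map_mul, map_pow, hz]
  rw [pow_sub₀ _ hz0 hk.2, pow_add, inv_pow]
  ring

theorem encard_zeros_Ico_le {c : ℕ → ℂ} (hc : c 1 ≠ 0) {n : ℕ} (hn : 1 ≤ n) :
    {t : ℝ | t ∈ Set.Ico 0 (2 * Real.pi) ∧ (trigSum c n t).re = 0}.encard ≤ ((2 * n : ℕ) : ℕ∞) := by
  set s := {t : ℝ | t ∈ Set.Ico 0 (2 * Real.pi) ∧ (trigSum c n t).re = 0} with hs
  have hinj : Set.InjOn (fun t : ℝ => Complex.exp (t * Complex.I)) s :=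
    injOn_exp_mul_I.mono fun t ht => ht.1
  rw [← hinj.encard_image]
  have hsub : (fun t : ℝ => Complex.exp (t * Complex.I)) '' s ⊆
      ((trigSumPoly c n).roots.toFinset : Set ℂ) := by
    rintro _ ⟨t, ht, rfl⟩
    rw [Finset.mem_coe, Multiset.mem_toFinset, Polynomial.mem_roots (trigSumPoly_ne_zero hc hn),
      Polynomial.IsRoot.def, eval_trigSumPoly, ht.2]
    simp
  refine (Set.encard_le_encard hsub).trans ?_
  rw [Set.encard_coe_eq_coe_finsetCard]
  exact_mod_cast (Multiset.toFinset_card_le _).trans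
    ((Polynomial.card_roots' _).trans (natDegree_trigSumPoly_le c n))

theorem zeroCount_trigSum_le {c : ℕ → ℂ} (hc : c 1 ≠ 0) {n : ℕ} (hn : 1 ≤ n) :
    zeroCount (fun t => (trigSum c n t).re) ≤ ((2 * n + 1 : ℕ) : ℕ∞) := by
  refine (Set.encard_le_encard (t := insert (2 * Real.pi)
    {t : ℝ | t ∈ Set.Ico 0 (2 * Real.pi) ∧ (trigSum c n t).re = 0}) ?_).trans
    ((Set.encard_insert_le _ _).trans ?_)
  · rintro t ⟨ht, h⟩
    rcases ht.2.lt_or_eq with h' | h'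
    exacts [Or.inr ⟨⟨ht.1, h'⟩, h⟩, Or.inl h']
  · push_cast
    gcongr
    exact_mod_cast encard_zeros_Ico_le hc hn

/-- For $\alpha=0$ the $c_k$ all equal $c_1$. The endpoint $2\pi$ is no zero since
$\mathrm{Re}\,c_1\ne0$, so the degree bound gives at most $2n$. On the open interval $\cos t-1$
never vanishes, so nothing is lost: $\sin(nt/2)$ contributes $n-1$ zeros and the other factor, which
is $-2\sin(t/2)\,\mathrm{Re}(c_1e^{i(n+1)t/2})$, contributes $n+1$. -/
theorem IsGenericCosineSeq.zeroCount_eq {c : ℕ → ℂ} (h : IsGenericCosineSeq 0 c)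
    {n : ℕ} (hn : 1 ≤ n) : zeroCount (fun t => (trigSum c n t).re) = ((2 * n : ℕ) : ℕ∞) := by
  have hπ := Real.pi_pos
  have hconst : ∀ k, 1 ≤ k → c k = c 1 := by
    intro k hk
    have := h.periodic (k - 1) 1 le_rfl (by simp)
    rwa [mul_zero, Real.cos_zero, Complex.ofReal_one, one_mul, show 1 + (k - 1) = k by omega]
      at this
  have hz0 : zerothCoeff 0 c = c 1 := by
    rw [zerothCoeff, hconst 2 (by norm_num), Real.cos_zero]
    push_cast
    ring
  apply le_antisymm
  · refine (Set.encard_le_encard ?_).trans (encard_zeros_Ico_le h.ne_zero hn)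
    rintro t ⟨ht, h0⟩
    refine ⟨⟨ht.1, lt_of_le_of_ne ht.2 ?_⟩, h0⟩
    rintro rfl
    have h1 : trigSum c n (2 * Real.pi) = (n : ℝ) * c 1 := by
      rw [trigSum]
      push_cast
      rw [Complex.exp_two_pi_mul_I, Finset.sum_congr rfl fun k hk => by
        rw [one_pow, mul_one, hconst k (Finset.mem_Icc.1 hk).1]]
      simp
    have h2 : (trigSum c n (2 * Real.pi)).re = 0 := h0
    rw [h1, Complex.re_ofReal_mul, mul_eq_zero] at h2
    rcases h2 with h2 | h2
    · have : n = 0 := by exact_mod_cast h2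
      omega
    · exact h.re_ne_zero h2
  · have hS : (n : ℕ∞) ≤
        {t : ℝ | t ∈ Set.Ioo 0 (2 * Real.pi) ∧ Real.sin (n / 2 * t) = 0}.encard + 1 := by
      refine (le_encard_sin_half hn).trans ((Set.encard_le_encard (t := insert 0 _) ?_).trans
        (Set.encard_insert_le _ _))
      rintro t ⟨ht, h⟩
      rcases ht.1.eq_or_lt with h' | h'
      exacts [Or.inl h'.symm, Or.inr ⟨⟨h', ht.2⟩, h⟩]
    have hH0 : ((n + 1 : ℕ) : ℕ∞) ≤ {t : ℝ | t ∈ Set.Ioo 0 (2 * Real.pi) ∧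
        Real.cos ((n + 1) / 2 * t + (c 1).arg) = 0}.encard := by
      refine le_encard_zeros_cos (by push_cast; ring) (by omega) ?_
      rw [Complex.cos_arg h.ne_zero]
      exact div_ne_zero h.re_ne_zero (norm_ne_zero_iff.2 h.ne_zero)
    have hH : ((n + 1 : ℕ) : ℕ∞) ≤ {t : ℝ | t ∈ Set.Ioo 0 (2 * Real.pi) ∧
        ((-Complex.I * c 1 - -Complex.I * zerothCoeff 0 c * Complex.exp (t * Complex.I)) *
          Complex.exp ((n / 2 * t : ℝ) * Complex.I)).re = 0}.encard := by
      refine hH0.trans (Set.encard_le_encard ?_)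
      rintro t ⟨ht, h0⟩
      refine ⟨ht, ?_⟩
      have e1 : (-Complex.I * c 1 - -Complex.I * zerothCoeff 0 c * Complex.exp (t * Complex.I)) *
          Complex.exp ((n / 2 * t : ℝ) * Complex.I) = ((-2 * Real.sin (1 / 2 * t) : ℝ) : ℂ) *
          (c 1 * Complex.exp (((n + 1) / 2 * t : ℝ) * Complex.I)) := by
        have e2 : Complex.exp (((n + 1) / 2 * t : ℝ) * Complex.I) =
            Complex.exp ((1 / 2 * t : ℝ) * Complex.I) *
            Complex.exp ((n / 2 * t : ℝ) * Complex.I) := by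
          rw [← Complex.exp_add]; push_cast; ring_nf
        have e3 := exp_pow_eq_exp_half_sq 1 t
        have e4 := one_sub_exp_sq (1 / 2 * t)
        rw [pow_one, Nat.cast_one] at e3
        rw [hz0, e3, e2]
        push_cast at e4 ⊢
        generalize Complex.exp (1 / 2 * (t : ℂ) * Complex.I) = x at *
        generalize Complex.exp ((n : ℂ) / 2 * t * Complex.I) = y at *
        linear_combination (-Complex.I * c 1 * y) * e4 +
          (2 * Complex.sin (1 / 2 * t) * c 1 * x * y) * Complex.I_sq
      rw [e1, Complex.re_ofReal_mul, Complex.re_mul_exp_mul_I, h0, mul_zero, mul_zero]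
    have hf : ∀ t : ℝ, (Real.cos t - Real.cos 0) * (trigSum c n t).re =
        Real.sin (n / 2 * t) * ((-Complex.I * c 1 - -Complex.I * zerothCoeff 0 c *
          Complex.exp (t * Complex.I)) * Complex.exp ((n / 2 * t : ℝ) * Complex.I)).re := fun t => by
      have h1 := cos_sub_mul_trigSum_of_eq_one h (q := n) (by simp) (by simp) 0 t
      rwa [Complex.ofReal_zero, zero_mul, Complex.exp_zero, one_mul, zero_add] at h1
    have hp : {t : ℝ | t ∈ Set.Ioo 0 (2 * Real.pi) ∧ Real.cos t - Real.cos 0 = 0}.encard ≤ 0 := by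
      rw [nonpos_iff_eq_zero, Set.encard_eq_zero, Set.eq_empty_iff_forall_notMem]
      rintro t ⟨ht, h0⟩
      rw [Real.cos_zero, sub_eq_zero] at h0
      have := (Real.cos_eq_one_iff_of_lt_of_lt (by linarith [ht.1]) ht.2).1 h0
      linarith [ht.1]
    have h1 := le_encard_zeros_of_mul_eq hf hp le_rfl hH
      fun t h1 h2 => sub_eq_zero.2 (h.cos_eq_of_sin_half hn h1 h2)
    rw [add_zero, add_zero] at h1
    have h2 : ((2 * n : ℕ) : ℕ∞) + 1 ≤ zeroCount (fun t => (trigSum c n t).re) + 1 := by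
      calc ((2 * n : ℕ) : ℕ∞) + 1 = n + ((n + 1 : ℕ) : ℕ∞) := by push_cast; ring
        _ ≤ _ := add_le_add_left hS _
        _ = _ := add_right_comm _ _ _
        _ ≤ _ := add_le_add_left h1 1
        _ ≤ zeroCount (fun t => (trigSum c n t).re) + 1 := by
          refine add_le_add_left (Set.encard_le_encard ?_) 1
          exact fun t ht => ⟨Set.Ioo_subset_Icc_self ht.1, ht.2⟩
    exact (ENat.add_le_add_iff_right ENat.one_ne_top).1 h2

/-! ### Factorization when α = 2πp/q -/

/-- Here $t\equiv\pm\alpha$ modulo $2\pi$, and $q\alpha/2\in\pi\mathbb Z$. Hence $\sin(qt/2)\ne0$ is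
enough to cancel $\cos t-\cos\alpha$ in the factorization. -/
theorem sin_half_eq_zero_of_cos_eq {q : ℕ} {α t : ℝ} (hα : Real.sin (q * α / 2) = 0)
    (h : Real.cos t = Real.cos α) : Real.sin (q * t / 2) = 0 := by
  obtain ⟨m, hm⟩ := Real.sin_eq_zero_iff.1 hα
  obtain ⟨k, hk | hk⟩ := Real.cos_eq_cos_iff.1 h
  · refine Real.sin_eq_zero_iff.2 ⟨m - q * k, ?_⟩
    push_cast
    rw [hk] at hm
    linarith
  · refine Real.sin_eq_zero_iff.2 ⟨q * k - m, ?_⟩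
    push_cast
    rw [hk] at hm
    linarith

theorem IsGenericCosineSeq.trigSum_factorization {α : ℝ} {c : ℕ → ℂ} (h : IsGenericCosineSeq α c)
    {q n : ℕ} (hα : Real.sin (q * α / 2) = 0)
    (hq : Real.sin (q * α) = 0) (hq' : Real.cos (q * α) = 1)
    (hn : Real.sin (n * α) = 0) (hn' : Real.cos (n * α) = 1) {t : ℝ}
    (ht : Real.sin (q * t / 2) ≠ 0) :
    (trigSum c n t).re = (Complex.exp (((n - q) * t / 2 : ℝ) * Complex.I) * trigSum c q t).re *
      (Real.sin (n * t / 2) / Real.sin (q * t / 2)) := by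
  have hne : Real.cos t - Real.cos α ≠ 0 := fun h0 =>
    ht (sin_half_eq_zero_of_cos_eq hα (sub_eq_zero.1 h0))
  have h1 := cos_sub_mul_trigSum_of_eq_one h hn hn' 0 t
  have h2 := cos_sub_mul_trigSum_of_eq_one h hq hq' ((n - q) * t / 2) t
  rw [show ((n - q) * t / 2 + q / 2 * t : ℝ) = n / 2 * t by ring,
    show (q / 2 * t : ℝ) = q * t / 2 by ring] at h2
  rw [Complex.ofReal_zero, zero_mul, Complex.exp_zero, one_mul, zero_add] at h1
  rw [show Real.sin (n * t / 2) = Real.sin (n / 2 * t) by ring_nf]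
  apply mul_left_cancel₀ hne
  have h3 : ∀ w x : ℝ, Real.sin (q * t / 2) * w * (x / Real.sin (q * t / 2)) = x * w := by
    intro w x
    field_simp
  rw [← mul_assoc, h1, h2, h3]

/-! ### Measurability of the number of zeros -/

/-- By continuity and compactness, a zero exists exactly when $|F|$ takes arbitrarily small values
on a countable dense subset, which is a countable condition on point evaluations. -/
theorem nullMeasurableSet_exists_zero_Icc {Ω : Type*} [MeasurableSpace Ω] {P : Measure Ω}
    {F : Ω → ℝ → ℝ} (hF : ∀ ω, Continuous (F ω)) (hm : ∀ t, AEMeasurable (fun ω => F ω t) P)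
    (u v : ℝ) : NullMeasurableSet {ω | ∃ t ∈ Set.Icc u v, F ω t = 0} P := by
  obtain ⟨D, hDc, hD⟩ := TopologicalSpace.exists_countable_dense (Set.Icc u v)
  have key : {ω | ∃ t ∈ Set.Icc u v, F ω t = 0} =
      ⋂ m : ℕ, ⋃ s ∈ D, {ω | |F ω (s : ℝ)| < 1 / ((m : ℝ) + 1)} := by
    ext ω
    simp only [Set.mem_ofPred_eq, Set.mem_iInter, Set.mem_iUnion, exists_prop]
    constructor
    · rintro ⟨t, ht, h0⟩ m
      have ho : IsOpen {s : Set.Icc u v | |F ω (s : ℝ)| < 1 / ((m : ℝ) + 1)} :=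
        isOpen_lt (((hF ω).comp continuous_subtype_val).abs) continuous_const
      obtain ⟨s, hs1, hs2⟩ := hD.exists_mem_open ho ⟨⟨t, ht⟩, by
        simp only [Set.mem_ofPred_eq, h0, abs_zero]
        positivity⟩
      exact ⟨s, hs1, hs2⟩
    · intro h
      obtain ⟨s0, hs0, -⟩ := h 0
      obtain ⟨t, ht, hmin⟩ := isCompact_Icc.exists_isMinOn ⟨s0.1, s0.2⟩
        (hF ω).abs.continuousOn
      refine ⟨t, ht, ?_⟩
      by_contra hne
      obtain ⟨m, hm⟩ := exists_nat_one_div_lt (abs_pos.2 hne)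
      obtain ⟨s, -, hs⟩ := h m
      exact absurd (hmin s.2) (not_le.2 (hs.trans hm))
  rw [key]
  refine NullMeasurableSet.iInter fun m => NullMeasurableSet.biUnion hDc fun s _ => ?_
  exact nullMeasurableSet_lt (hm s).abs aemeasurable_const

/-- Finite families of pairwise disjoint compact intervals with rational endpoints. -/
def DisjointRatIntervals : Type :=
  {s : Finset (ℚ × ℚ) // (s : Set (ℚ × ℚ)).PairwiseDisjoint fun i => Set.Icc (i.1 : ℝ) i.2}

instance : Countable DisjointRatIntervals := inferInstanceAs (Countable (Subtype _))

theorem exists_disjoint_rat_intervals (T : Finset ℝ) : ∃ s : DisjointRatIntervals,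
    s.1.card = T.card ∧ ∀ i ∈ s.1, ∃ t ∈ T, t ∈ Set.Icc (i.1 : ℝ) i.2 := by
  obtain ⟨U, hU, hdisj⟩ := T.finite_toSet.t2_separation
  have h : ∀ t : ℝ, ∃ i : ℚ × ℚ, t ∈ Set.Icc (i.1 : ℝ) i.2 ∧ Set.Icc (i.1 : ℝ) i.2 ⊆ U t := by
    intro t
    obtain ⟨l, r, ht, hlr⟩ := mem_nhds_iff_exists_Ioo_subset.1 ((hU t).2.mem_nhds (hU t).1)
    obtain ⟨p, hp1, hp2⟩ := exists_rat_btwn ht.1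
    obtain ⟨q, hq1, hq2⟩ := exists_rat_btwn ht.2
    exact ⟨(p, q), ⟨hp2.le, hq1.le⟩, fun x hx => hlr ⟨hp1.trans_le hx.1, hx.2.trans_lt hq2⟩⟩
  choose φ hφ hφU using h
  have hinj : Set.InjOn φ T := by
    intro x hx y hy hxy
    by_contra hne
    exact Set.disjoint_left.1 (hdisj hx hy hne) (hφU x (hφ x)) (hφU y (hxy ▸ hφ x))
  refine ⟨⟨T.image φ, ?_⟩, Finset.card_image_of_injOn hinj, ?_⟩
  · intro i hi j hj hij
    simp only [Finset.coe_image, Set.mem_image, Finset.mem_coe] at hi hj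
    obtain ⟨x, hx, rfl⟩ := hi
    obtain ⟨y, hy, rfl⟩ := hj
    exact (hdisj hx hy fun h => hij (congrArg φ h)).mono (hφU x) (hφU y)
  · intro i hi
    obtain ⟨x, hx, rfl⟩ := Finset.mem_image.1 hi
    exact ⟨x, hx, hφ x⟩

-- Disjoint intervals that each contain a zero give distinct zeros; conversely finitely many zeros
-- can be separated by disjoint rational intervals. The index set is countable, so measurability
-- passes to the supremum, infinite counts included.
open Classical in
theorem zeroCount_eq_iSup (f : ℝ → ℝ) :
    zeroCount f = ⨆ s : DisjointRatIntervals,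
      if ∀ i ∈ s.1, ∃ t ∈ Set.Icc (max (i.1 : ℝ) 0) (min (i.2 : ℝ) (2 * Real.pi)), f t = 0
      then (s.1.card : ℕ∞) else 0 := by
  apply le_antisymm
  · refine ENat.forall_natCast_le_iff_le.1 fun k hk => ?_
    obtain ⟨T, hT, hTk⟩ := Set.exists_subset_encard_eq hk
    have hTfin : T.Finite := Set.finite_of_encard_eq_coe hTk
    lift T to Finset ℝ using hTfin
    rw [Set.encard_coe_eq_coe_finsetCard, Nat.cast_inj] at hTk
    obtain ⟨s, hs, hsT⟩ := exists_disjoint_rat_intervals T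
    refine le_iSup_of_le s ?_
    rw [if_pos, hs, hTk]
    intro i hi
    obtain ⟨t, ht, hti⟩ := hsT i hi
    have h1 := hT ht
    exact ⟨t, ⟨max_le hti.1 h1.1.1, le_min hti.2 h1.1.2⟩, h1.2⟩
  · refine iSup_le fun s => ?_
    split_ifs with h
    · choose! z hz hz0 using h
      rw [← Set.encard_coe_eq_coe_finsetCard]
      have hmem : ∀ i ∈ s.1, z i ∈ Set.Icc (i.1 : ℝ) i.2 := fun i hi =>
        ⟨(le_max_left _ _).trans (hz i hi).1, (hz i hi).2.trans (min_le_left _ _)⟩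
      have hinj : Set.InjOn z s.1 := by
        intro i hi j hj hij
        by_contra hne
        exact Set.disjoint_left.1 (s.2 hi hj hne) (hmem i hi) (hij ▸ hmem j hj)
      rw [← hinj.encard_image]
      refine Set.encard_le_encard ?_
      rintro _ ⟨i, hi, rfl⟩
      exact ⟨⟨(le_max_right _ _).trans (hz i hi).1, (hz i hi).2.trans (min_le_right _ _)⟩, hz0 i hi⟩
    · exact zero_le

theorem aemeasurable_zeroCount {Ω : Type*} [MeasurableSpace Ω] {P : Measure Ω}
    {F : Ω → ℝ → ℝ} (hF : ∀ ω, Continuous (F ω)) (hm : ∀ t, AEMeasurable (fun ω => F ω t) P) :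
    AEMeasurable (fun ω => (zeroCount (F ω) : ℝ≥0∞)) P := by
  classical
  simp_rw [zeroCount_eq_iSup, ENat.toENNReal_iSup]
  refine AEMeasurable.iSup fun s => ?_
  have hs : NullMeasurableSet {ω | ∀ i ∈ s.1, ∃ t ∈ Set.Icc (max (i.1 : ℝ) 0)
      (min (i.2 : ℝ) (2 * Real.pi)), F ω t = 0} P := by
    simp only [Set.ofPred_forall]
    exact NullMeasurableSet.biInter (Finset.countable_toSet _)
      fun i _ => nullMeasurableSet_exists_zero_Icc hF hm _ _
  refine ((aemeasurable_const (b := (s.1.card : ℝ≥0∞))).indicator₀ hs).congr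
    (Eventually.of_forall fun ω => ?_)
  simp only [Set.indicator_apply, Set.mem_ofPred_eq]
  split_ifs <;> simp

/-! ### Almost sure properties of the Gaussian coefficients -/

section Gaussian

variable {Ω : Type*} [MeasurableSpace Ω] {P : Measure Ω} {α : ℝ} {X a b : ℕ → Ω → ℝ}

theorem IsStationaryGaussian.memLp {ρ : ℕ → ℝ} (h : IsStationaryGaussian ρ X P) {k : ℕ}
    (hk : 1 ≤ k) : MemLp (X k) 2 P :=
  (h.gaussian.hasGaussianLaw_eval ⟨k, hk⟩).memLp_two

theorem IsStationaryGaussian.aemeasurable {ρ : ℕ → ℝ} (h : IsStationaryGaussian ρ X P) {k : ℕ}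
    (hk : 1 ≤ k) : AEMeasurable (X k) P :=
  h.gaussian.aemeasurable ⟨k, hk⟩

theorem IsStationaryGaussian.integral_mul
    (h : IsStationaryGaussian (fun k : ℕ => Real.cos (k * α)) X P) {k l : ℕ}
    (hk : 1 ≤ k) (hl : 1 ≤ l) :
    ∫ ω, X k ω * X l ω ∂P = Real.cos (((k : ℝ) - l) * α) := by
  rcases le_total k l with hkl | hkl
  · obtain ⟨j, rfl⟩ := Nat.exists_eq_add_of_le hkl
    rw [h.correlation k j hk, ← Real.cos_neg]
    push_cast
    ring_nf
  · obtain ⟨j, rfl⟩ := Nat.exists_eq_add_of_le hkl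
    simp_rw [mul_comm (X (l + j) _)]
    rw [h.correlation l j hl]
    push_cast
    ring_nf

theorem IsStationaryGaussian.integral_sq
    (h : IsStationaryGaussian (fun k : ℕ => Real.cos (k * α)) X P) {k l m : ℕ}
    (hk : 1 ≤ k) (hl : 1 ≤ l) (hm : 1 ≤ m) (x y w : ℝ) :
    ∫ ω, (x * X k ω + y * X l ω + w * X m ω) ^ 2 ∂P = x ^ 2 + y ^ 2 + w ^ 2 +
      2 * x * y * Real.cos (((k : ℝ) - l) * α) + 2 * x * w * Real.cos (((k : ℝ) - m) * α) +
      2 * y * w * Real.cos (((l : ℝ) - m) * α) := by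
  have I : ∀ (r : ℝ) {i j : ℕ}, 1 ≤ i → 1 ≤ j → Integrable (fun ω => r * (X i ω * X j ω)) P :=
    fun r i j hi hj => ((h.memLp hi).integrable_mul (h.memLp hj)).const_mul r
  have e : ∀ ω, (x * X k ω + y * X l ω + w * X m ω) ^ 2 =
      x ^ 2 * (X k ω * X k ω) + (y ^ 2 * (X l ω * X l ω) + (w ^ 2 * (X m ω * X m ω) +
      (2 * x * y * (X k ω * X l ω) + (2 * x * w * (X k ω * X m ω) +
      2 * y * w * (X l ω * X m ω))))) := fun ω => by ring
  simp_rw [e]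
  have I5 := (I (2 * x * w) hk hm).fun_add (I (2 * y * w) hl hm)
  have I4 := (I (2 * x * y) hk hl).fun_add I5
  have I3 := (I (w ^ 2) hm hm).fun_add I4
  have I2 := (I (y ^ 2) hl hl).fun_add I3
  rw [integral_add (I _ hk hk) I2, integral_add (I _ hl hl) I3, integral_add (I _ hm hm) I4,
    integral_add (I _ hk hl) I5, integral_add (I _ hk hm) (I _ hl hm)]
  simp_rw [integral_const_mul]
  rw [h.integral_mul hk hk, h.integral_mul hl hl, h.integral_mul hm hm, h.integral_mul hk hl,
    h.integral_mul hk hm, h.integral_mul hl hm]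
  simp only [sub_self, zero_mul, Real.cos_zero]
  ring

/-- A linear combination with zero second moment vanishes almost surely; this is how the degeneracy
of the covariance becomes pathwise identities. -/
theorem IsStationaryGaussian.ae_eq_zero
    (h : IsStationaryGaussian (fun k : ℕ => Real.cos (k * α)) X P) {k l m : ℕ}
    (hk : 1 ≤ k) (hl : 1 ≤ l) (hm : 1 ≤ m) {x y w : ℝ}
    (h0 : x ^ 2 + y ^ 2 + w ^ 2 +
      2 * x * y * Real.cos (((k : ℝ) - l) * α) + 2 * x * w * Real.cos (((k : ℝ) - m) * α) +
      2 * y * w * Real.cos (((l : ℝ) - m) * α) = 0) :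
    ∀ᵐ ω ∂P, x * X k ω + y * X l ω + w * X m ω = 0 := by
  rw [← h.integral_sq hk hl hm, integral_eq_zero_iff_of_nonneg (fun ω => sq_nonneg _)] at h0
  · filter_upwards [h0] with ω hω
    simpa using hω
  · exact ((((h.memLp hk).const_mul x).add ((h.memLp hl).const_mul y)).add
      ((h.memLp hm).const_mul w)).integrable_sq

theorem IsStationaryGaussian.ae_recurrence
    (h : IsStationaryGaussian (fun k : ℕ => Real.cos (k * α)) X P) :
    ∀ᵐ ω ∂P, ∀ k : ℕ, 1 ≤ k → X (k + 2) ω = 2 * Real.cos α * X (k + 1) ω - X k ω := by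
  rw [ae_all_iff]
  intro k
  by_cases hk : 1 ≤ k
  · filter_upwards [h.ae_eq_zero (k := k + 2) (l := k + 1) (m := k) (x := 1)
      (y := -(2 * Real.cos α)) (w := 1) (by omega) (by omega) hk (by
        push_cast
        rw [show ((k : ℝ) + 2 - (k + 1)) * α = α by ring, show ((k : ℝ) + 2 - k) * α = 2 * α by ring,
          show ((k : ℝ) + 1 - k) * α = α by ring, Real.cos_two_mul]
        ring)] with ω hω _
    linarith
  · exact Eventually.of_forall fun ω hk' => absurd hk' hk

theorem IsStationaryGaussian.ae_periodic
    (h : IsStationaryGaussian (fun k : ℕ => Real.cos (k * α)) X P) :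
    ∀ᵐ ω ∂P, ∀ n k : ℕ, 1 ≤ k → Real.sin (n * α) = 0 →
      X (k + n) ω = Real.cos (n * α) * X k ω := by
  simp_rw [ae_all_iff]
  intro n k hk hn
  -- The second moment is $1-\cos^2(n\alpha)=\sin^2(n\alpha)=0$; the third term is a dummy with
  -- weight 0.
  filter_upwards [h.ae_eq_zero (k := k + n) (l := k) (m := k) (x := 1)
    (y := -Real.cos (n * α)) (w := 0) (by omega) hk hk (by
      have := Real.sin_sq_add_cos_sq (n * α)
      push_cast
      rw [show ((k : ℝ) + n - k) * α = n * α by ring]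
      rw [hn] at this
      linarith)] with ω hω
  linarith

theorem HasGaussianLaw.ae_ne_zero {Y : Ω → ℝ} (h : HasGaussianLaw Y P) (hv : Var[Y; P] ≠ 0) :
    ∀ᵐ ω ∂P, Y ω ≠ 0 := by
  have hv' : Var[Y; P].toNNReal ≠ 0 := by
    rw [Ne, Real.toNNReal_eq_zero, not_le]
    exact lt_of_le_of_ne (variance_nonneg _ _) hv.symm
  have := nullSingletonClass_gaussianReal (μ := P[Y]) hv'
  have h1 : P.map Y {0} = 0 := by
    rw [h.map_eq_gaussianReal]
    exact measure_singleton 0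
  rw [Measure.map_apply_of_aemeasurable h.aemeasurable (measurableSet_singleton 0)] at h1
  exact measure_eq_zero_iff_ae_notMem.1 h1

theorem IsStationaryGaussian.hasGaussianLaw_linear {ρ : ℕ → ℝ} (h : IsStationaryGaussian ρ X P)
    {k l : ℕ} (hk : 1 ≤ k) (hl : 1 ≤ l) (x y : ℝ) :
    HasGaussianLaw (fun ω => x * X k ω + y * X l ω) P :=
  (h.gaussian.hasGaussianLaw_prodMk (s := ⟨k, hk⟩) (t := ⟨l, hl⟩)).map_fun
    (x • ContinuousLinearMap.fst ℝ ℝ ℝ + y • ContinuousLinearMap.snd ℝ ℝ ℝ)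

theorem IsStationaryGaussian.variance_linear [IsProbabilityMeasure P]
    (h : IsStationaryGaussian (fun k : ℕ => Real.cos (k * α)) X P) (x y : ℝ) :
    Var[fun ω => x * X 1 ω + y * X 2 ω; P] = x ^ 2 + y ^ 2 + 2 * x * y * Real.cos α := by
  have I : ∀ (r : ℝ) {i : ℕ}, 1 ≤ i → Integrable (fun ω => r * X i ω) P :=
    fun r i hi => ((h.memLp hi).integrable one_le_two).const_mul r
  rw [variance_of_integral_eq_zero (h.hasGaussianLaw_linear le_rfl one_le_two x y).aemeasurable]
  · have := h.integral_sq (k := 1) (l := 2) (m := 1) le_rfl one_le_two le_rfl x y 0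
    simp only [zero_mul, add_zero, mul_zero] at this
    rw [this]
    push_cast
    rw [show ((1 : ℝ) - 2) * α = -α by ring, Real.cos_neg]
    ring
  · rw [integral_add (I x le_rfl) (I y one_le_two), integral_const_mul, integral_const_mul,
      h.mean_zero 1 le_rfl, h.mean_zero 2 one_le_two]
    simp

/-- By independence the combination is Gaussian and the variances add, so a nonzero total variance
excludes an atom at 0. -/
theorem IsCosineGaussianPair.ae_ne_zero [IsProbabilityMeasure P]
    (h : IsCosineGaussianPair α a b P) {x y u v : ℝ}
    (h0 : (x ^ 2 + y ^ 2 + 2 * x * y * Real.cos α) +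
      (u ^ 2 + v ^ 2 + 2 * u * v * Real.cos α) ≠ 0) :
    ∀ᵐ ω ∂P, (x * a 1 ω + y * a 2 ω) + (u * b 1 ω + v * b 2 ω) ≠ 0 := by
  have hY := h.left.hasGaussianLaw_linear le_rfl one_le_two x y
  have hZ := h.right.hasGaussianLaw_linear le_rfl one_le_two u v
  have hφ : ∀ x y : ℝ, Measurable fun f : ℕ+ → ℝ => x * f 1 + y * f 2 := by
    intro x y
    fun_prop
  have hind : IndepFun (fun ω => x * a 1 ω + y * a 2 ω) (fun ω => u * b 1 ω + v * b 2 ω) P :=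
    h.indep.comp (hφ x y) (hφ u v)
  refine HasGaussianLaw.ae_ne_zero (hind.hasGaussianLaw hY hZ).fun_add ?_
  rw [hind.variance_fun_add hY.memLp_two hZ.memLp_two, h.left.variance_linear,
    h.right.variance_linear]
  exact h0

/-- The complex coefficients `a_k - i b_k` of a realization. -/
noncomputable def complexCoeff (a b : ℕ → Ω → ℝ) (ω : Ω) (k : ℕ) : ℂ :=
  (a k ω : ℂ) - b k ω * Complex.I

theorem IsCosineGaussianPair.ae_isGenericCosineSeq [IsProbabilityMeasure P]
    (h : IsCosineGaussianPair α a b P) :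
    ∀ᵐ ω ∂P, IsGenericCosineSeq α (complexCoeff a b ω) := by
  have him : ∀ᵐ ω ∂P, ∀ r : ℚ, Real.cos (r * Real.pi) ≠ Real.cos α →
      (complexCoeff a b ω 1 - zerothCoeff α (complexCoeff a b ω) *
        Complex.exp ((r * Real.pi : ℝ) * Complex.I)).im ≠ 0 := by
    simp_rw [ae_all_iff]
    intro r hr
    set C := Real.cos (r * Real.pi) with hC
    set s := Real.sin (r * Real.pi) with hs
    set γ := Real.cos α with hγ
    have hsC : s ^ 2 + C ^ 2 = 1 := Real.sin_sq_add_cos_sq _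
    have hpos : 0 < (C - γ) ^ 2 := by
      have := sub_ne_zero.2 hr
      positivity
    have hγ1 : γ ^ 2 ≤ 1 := Real.cos_sq_le_one _
    -- These are the coordinates of $\mathrm{Im}(c_1-(2\gamma c_1-c_2)(C+is))$ in $a_1,a_2,b_1,b_2$.
    -- The variance is $(C-\gamma)^2+(1-\gamma^2)+s^2$, positive since $C\ne\gamma$; only countably
    -- many angles are needed.
    have := h.ae_ne_zero (x := -(2 * γ * s)) (y := s) (u := -(1 - 2 * γ * C)) (v := -C) (by
      apply ne_of_gt
      rw [← hγ]
      have e : (-(2 * γ * s)) ^ 2 + s ^ 2 + 2 * -(2 * γ * s) * s * γ +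
          ((-(1 - 2 * γ * C)) ^ 2 + (-C) ^ 2 + 2 * -(1 - 2 * γ * C) * -C * γ) =
          (C - γ) ^ 2 + (1 - γ ^ 2) + s ^ 2 := by ring
      rw [e]
      have := sq_nonneg s
      linarith)
    filter_upwards [this] with ω hω h0
    apply hω
    rw [exp_ofReal_mul_I] at h0
    rw [zerothCoeff, complexCoeff, complexCoeff, ← hγ, ← hC, ← hs] at h0
    simp [-Complex.ofReal_cos, -Complex.ofReal_sin] at h0
    linarith
  filter_upwards [h.left.ae_recurrence, h.right.ae_recurrence, h.left.ae_periodic,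
    h.right.ae_periodic, h.ae_ne_zero (x := 1) (y := 0) (u := 0) (v := 0) (by norm_num), him]
    with ω h1 h2 h3 h4 h5 h6
  refine ⟨fun k hk => ?_, fun n k hk hn => ?_, ?_, h6⟩
  · rw [complexCoeff, complexCoeff, complexCoeff, h1 k hk, h2 k hk]
    push_cast
    ring
  · rw [complexCoeff, complexCoeff, h3 n k hk hn, h4 n k hk hn]
    push_cast
    ring
  · simpa [complexCoeff] using h5

end Gaussian

/-! ### The random functions as real parts of trigonometric sums -/

section Realizations

variable {Ω : Type*} {a b : ℕ → Ω → ℝ}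

theorem exp_mul_complexCoeff_re (ω : Ω) (s t : ℝ) (k : ℕ) :
    (Complex.exp (s * Complex.I) * (complexCoeff a b ω k * Complex.exp (t * Complex.I) ^ k)).re =
      a k ω * Real.cos (k * t + s) + b k ω * Real.sin (k * t + s) := by
  have e : Complex.exp (s * Complex.I) * (complexCoeff a b ω k *
      Complex.exp (t * Complex.I) ^ k) = complexCoeff a b ω k *
      Complex.exp ((k * t + s : ℝ) * Complex.I) := by
    rw [mul_left_comm, ← Complex.exp_nat_mul, ← Complex.exp_add]
    push_cast
    ring_nf
  rw [e, exp_ofReal_mul_I, complexCoeff]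
  simp [-Complex.ofReal_cos, -Complex.ofReal_sin]

theorem exp_mul_trigSum_re (ω : Ω) (s t : ℝ) (n : ℕ) :
    (Complex.exp (s * Complex.I) * trigSum (complexCoeff a b ω) n t).re =
      ∑ k ∈ Finset.Icc 1 n, (a k ω * Real.cos (k * t + s) + b k ω * Real.sin (k * t + s)) := by
  rw [trigSum, Finset.mul_sum, Complex.re_sum]
  exact Finset.sum_congr rfl fun k _ => exp_mul_complexCoeff_re ω s t k

theorem randTrigPoly_eq (n : ℕ) (ω : Ω) (t : ℝ) : randTrigPoly a b n ω t =
    1 / Real.sqrt n * (trigSum (complexCoeff a b ω) n t).re := by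
  have := exp_mul_trigSum_re (a := a) (b := b) ω 0 t n
  rw [Complex.ofReal_zero, zero_mul, Complex.exp_zero, one_mul] at this
  rw [randTrigPoly, this]
  simp

theorem randTrigFactor_eq (q n : ℕ) (ω : Ω) : randTrigFactor a b q n ω = fun t =>
    (Complex.exp (((n - q) * t / 2 : ℝ) * Complex.I) * trigSum (complexCoeff a b ω) q t).re := by
  ext t
  rw [exp_mul_trigSum_re, randTrigFactor]

theorem zeroCount_randTrigPoly {n : ℕ} (hn : 1 ≤ n) (ω : Ω) : zeroCount (randTrigPoly a b n ω) =
    zeroCount fun t => (trigSum (complexCoeff a b ω) n t).re := by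
  have h : 1 / Real.sqrt n ≠ 0 := by positivity
  simp only [zeroCount, randTrigPoly_eq, mul_eq_zero, h, false_or]

theorem continuous_randTrigPoly (n : ℕ) (ω : Ω) : Continuous (randTrigPoly a b n ω) := by
  unfold randTrigPoly
  fun_prop

theorem continuous_randTrigFactor (q n : ℕ) (ω : Ω) : Continuous (randTrigFactor a b q n ω) := by
  unfold randTrigFactor
  fun_prop

end Realizations

/-! ### From pathwise bounds to expectations -/

section Expectation

variable {Ω : Type*} [MeasurableSpace Ω] {P : Measure Ω} {α : ℝ} {a b : ℕ → Ω → ℝ}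

theorem IsCosineGaussianPair.aemeasurable_zeroCount_randTrigPoly
    (h : IsCosineGaussianPair α a b P) (n : ℕ) :
    AEMeasurable (fun ω => (zeroCount (randTrigPoly a b n ω) : ℝ≥0∞)) P := by
  refine aemeasurable_zeroCount (continuous_randTrigPoly n) fun t => ?_
  refine (Finset.aemeasurable_fun_sum _ fun k hk => ?_).const_mul _
  have hk1 := (Finset.mem_Icc.1 hk).1
  exact ((h.left.aemeasurable hk1).mul_const _).add ((h.right.aemeasurable hk1).mul_const _)

theorem IsCosineGaussianPair.aemeasurable_zeroCount_randTrigFactor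
    (h : IsCosineGaussianPair α a b P) (q n : ℕ) :
    AEMeasurable (fun ω => (zeroCount (randTrigFactor a b q n ω) : ℝ≥0∞)) P := by
  refine aemeasurable_zeroCount (continuous_randTrigFactor q n) fun t => ?_
  refine Finset.aemeasurable_fun_sum _ fun k hk => ?_
  have hk1 := (Finset.mem_Icc.1 hk).1
  exact ((h.left.aemeasurable hk1).mul_const _).add ((h.right.aemeasurable hk1).mul_const _)

theorem expectedZeros_le [IsProbabilityMeasure P] {F : Ω → ℝ → ℝ} {m : ℕ}
    (h : ∀ᵐ ω ∂P, zeroCount (F ω) ≤ m) : expectedZeros P F ≤ m := by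
  calc expectedZeros P F ≤ ∫⁻ _, (m : ℝ≥0∞) ∂P :=
        lintegral_mono_ae (h.mono fun ω hω => by exact_mod_cast ENat.toENNReal_le.2 hω)
    _ = m := by simp

theorem le_expectedZeros_add [IsProbabilityMeasure P] {F : Ω → ℝ → ℝ} {m l : ℕ}
    (h : ∀ᵐ ω ∂P, (m : ℕ∞) ≤ zeroCount (F ω) + l) : (m : ℝ≥0∞) ≤ expectedZeros P F + l := by
  calc (m : ℝ≥0∞) = ∫⁻ _, (m : ℝ≥0∞) ∂P := by simp
    _ ≤ ∫⁻ ω, ((zeroCount (F ω) : ℝ≥0∞) + l) ∂P :=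
        lintegral_mono_ae (h.mono fun ω hω => by exact_mod_cast ENat.toENNReal_le.2 hω)
    _ = expectedZeros P F + l := by
        rw [lintegral_add_right _ measurable_const, expectedZeros]
        simp

theorem IsCosineGaussianPair.expectedZeros_randTrigPoly_le [IsProbabilityMeasure P]
    (h : IsCosineGaussianPair α a b P) {n : ℕ} (hn : 1 ≤ n) :
    expectedZeros P (randTrigPoly a b n) ≤ (2 * n + 1 : ℕ) :=
  expectedZeros_le (h.ae_isGenericCosineSeq.mono fun ω hω => by
    rw [zeroCount_randTrigPoly hn]
    exact zeroCount_trigSum_le hω.ne_zero hn)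

theorem IsCosineGaussianPair.le_expectedZeros_randTrigPoly [IsProbabilityMeasure P]
    (h : IsCosineGaussianPair α a b P) {n : ℕ} (hn : 1 ≤ n) (hs : Real.sin (n * α) = 0) :
    ((2 * n : ℕ) : ℝ≥0∞) ≤ expectedZeros P (randTrigPoly a b n) + (5 : ℕ) :=
  le_expectedZeros_add (h.ae_isGenericCosineSeq.mono fun ω hω => by
    rw [zeroCount_randTrigPoly hn]
    exact hω.le_zeroCount hn hs)

theorem IsCosineGaussianPair.le_expectedZeros_randTrigFactor [IsProbabilityMeasure P]
    (h : IsCosineGaussianPair α a b P) {q n : ℕ} (hn : 1 ≤ n) (hs : Real.sin (q * α) = 0)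
    (hc : Real.cos (q * α) = 1) :
    (n : ℝ≥0∞) ≤ expectedZeros P (randTrigFactor a b q n) + (3 : ℕ) :=
  le_expectedZeros_add (h.ae_isGenericCosineSeq.mono fun ω hω => by
    rw [randTrigFactor_eq]
    exact hω.le_zeroCount_factor hn hs hc)

theorem IsCosineGaussianPair.tendsto_expectedZeros [IsProbabilityMeasure P]
    (h : IsCosineGaussianPair α a b P) :
    Tendsto
      (fun n : ℕ => |(expectedZeros P (randTrigPoly a b n)).toReal / n - 2| *
        Set.indicator {m : ℕ | ∃ j : ℤ, (m : ℝ) * α = j * Real.pi} (fun _ => (1 : ℝ)) n)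
      atTop (𝓝 0) := by
  -- On the indicator set the expectation lies between $2n-5$ and $2n+1$.
  refine squeeze_zero' (g := fun n : ℕ => 5 / (n : ℝ)) (Eventually.of_forall fun n =>
    mul_nonneg (abs_nonneg _) (Set.indicator_nonneg (fun _ _ => zero_le_one) _)) ?_
    (tendsto_const_div_atTop_nhds_zero_nat 5)
  filter_upwards [eventually_ge_atTop 1] with n hn
  by_cases hmem : n ∈ {m : ℕ | ∃ j : ℤ, (m : ℝ) * α = j * Real.pi}
  · rw [Set.indicator_of_mem hmem, mul_one]
    obtain ⟨j, hj⟩ := hmem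
    have hs : Real.sin (n * α) = 0 := by rw [hj, Real.sin_int_mul_pi]
    have hle := h.expectedZeros_randTrigPoly_le hn
    have hge := h.le_expectedZeros_randTrigPoly hn hs
    have hfin := ne_top_of_le_ne_top (ENNReal.natCast_ne_top _) hle
    lift expectedZeros P (randTrigPoly a b n) to NNReal using hfin with E
    have hle' : (E : ℝ) ≤ 2 * n + 1 := by exact_mod_cast hle
    have hge' : (2 * n : ℝ) ≤ E + 5 := by exact_mod_cast hge
    have hn0 : (0 : ℝ) < n := by positivity
    rw [ENNReal.coe_toReal, show (E : ℝ) / n - 2 = (E - 2 * n) / n by field_simp, abs_div,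
      abs_of_pos hn0]
    gcongr
    rw [abs_le]
    constructor <;> linarith
  · rw [Set.indicator_of_notMem hmem, mul_zero]
    positivity

theorem IsCosineGaussianPair.one_le_liminf [IsProbabilityMeasure P]
    (h : IsCosineGaussianPair α a b P) {q : ℕ} (hs : Real.sin (q * α) = 0)
    (hc : Real.cos (q * α) = 1) :
    1 ≤ liminf (fun n : ℕ => expectedZeros P (randTrigFactor a b q n) / (n : ℝ≥0∞))
      (atTop ⊓ 𝓟 {n : ℕ | q ∣ n}) := by
  -- The bound $n-3$ on the expectation holds for all $n\ge1$, so the restriction to multiples of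
  -- $q$ can be dropped: a liminf along a finer filter is only larger.
  refine le_trans ?_ (liminf_le_liminf_of_le inf_le_left)
  have hlim : Tendsto (fun n : ℕ => (1 : ℝ≥0∞) - 3 / n) atTop (𝓝 1) := by
    have h1 : Tendsto (fun n : ℕ => (3 : ℝ≥0∞) / n) atTop (𝓝 0) := by
      simpa using ENNReal.Tendsto.const_div ENNReal.tendsto_nat_nhds_top
        (Or.inr (by norm_num : (3 : ℝ≥0∞) ≠ ⊤))
    simpa using ENNReal.Tendsto.sub tendsto_const_nhds h1 (Or.inl ENNReal.one_ne_top)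
  rw [← hlim.liminf_eq]
  refine liminf_le_liminf ?_
  filter_upwards [eventually_ge_atTop 1] with n hn
  have h1 := h.le_expectedZeros_randTrigFactor hn hs hc
  have hn0 : (n : ℝ≥0∞) ≠ 0 := by
    have : n ≠ 0 := by omega
    exact_mod_cast this
  rw [tsub_le_iff_right, ← ENNReal.add_div, ENNReal.le_div_iff_mul_le (Or.inl hn0)
    (Or.inl (ENNReal.natCast_ne_top _)), one_mul]
  exact_mod_cast h1

end Expectation

/-! ### Assembly of the three statements -/

theorem proposition1 {Ω : Type*} [MeasurableSpace Ω] (P : Measure Ω) [IsProbabilityMeasure P]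
    (α : ℝ) (hα : 0 ≤ α) (a b : ℕ → Ω → ℝ) (hab : IsCosineGaussianPair α a b P) :
    -- the case `α = 0`
    (α = 0 → ∀ᵐ ω ∂P, ∀ n : ℕ, 1 ≤ n → zeroCount (randTrigPoly a b n ω) = ((2 * n : ℕ) : ℕ∞)) ∧
    -- the case `α ∈ π ℚ`; the number of zeros is a random variable with finite expectation
    ((∃ r : ℚ, α = r * Real.pi) →
      (∀ n : ℕ, 1 ≤ n →
        AEMeasurable (fun ω => (zeroCount (randTrigPoly a b n ω) : ℝ≥0∞)) P ∧
        expectedZeros P (randTrigPoly a b n) ≠ ∞) ∧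
      Tendsto
        (fun n : ℕ => |(expectedZeros P (randTrigPoly a b n)).toReal / n - 2| *
          Set.indicator {m : ℕ | ∃ j : ℤ, (m : ℝ) * α = j * Real.pi} (fun _ => (1 : ℝ)) n)
        atTop (𝓝 0)) ∧
    -- the case `α = 2 π p / q`, `q ∣ n`: factorization and zeros of the random factor
    (∀ p q : ℕ, 0 < p → 0 < q → p.Coprime q → α = 2 * Real.pi * p / q →
      (∀ᵐ ω ∂P, ∀ n : ℕ, 1 ≤ n → q ∣ n → ∀ t : ℝ, Real.sin (q * t / 2) ≠ 0 →
        randTrigPoly a b n ω t =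
          1 / Real.sqrt n * randTrigFactor a b q n ω t *
            (Real.sin (n * t / 2) / Real.sin (q * t / 2))) ∧
      (∀ n : ℕ, 1 ≤ n → q ∣ n →
        AEMeasurable (fun ω => (zeroCount (randTrigFactor a b q n ω) : ℝ≥0∞)) P) ∧
      1 ≤ liminf (fun n : ℕ => expectedZeros P (randTrigFactor a b q n) / (n : ℝ≥0∞))
        (atTop ⊓ 𝓟 {n : ℕ | q ∣ n})) := by

  refine ⟨?_, ?_, ?_⟩
  · rintro rfl
    filter_upwards [hab.ae_isGenericCosineSeq] with ω hω n hn
    rw [zeroCount_randTrigPoly hn, hω.zeroCount_eq hn]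
  · intro _
    exact ⟨fun n hn => ⟨hab.aemeasurable_zeroCount_randTrigPoly n,
      ne_top_of_le_ne_top (ENNReal.natCast_ne_top _) (hab.expectedZeros_randTrigPoly_le hn)⟩,
      hab.tendsto_expectedZeros⟩
  · intro p q _ hq _ hαpq
    have hq0 : (q : ℝ) ≠ 0 := by positivity
    -- Every multiple of $q$ sends $\alpha$ to a multiple of $2\pi$, so for $q\mid n$ the sign in
    -- $c_{k+n}=\pm c_k$ is $+$ and the sine factorization applies to both $q$ and $n$.
    have hmul : ∀ m : ℕ, ((q * m : ℕ) : ℝ) * α = (p * m : ℕ) * (2 * Real.pi) := by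
      intro m
      rw [hαpq]
      push_cast
      field_simp
    have hsin : ∀ m : ℕ, Real.sin ((q * m : ℕ) * α) = 0 := fun m => by
      rw [hmul, Real.sin_eq_zero_iff]
      exact ⟨2 * (p * m : ℕ), by push_cast; ring⟩
    have hcos : ∀ m : ℕ, Real.cos ((q * m : ℕ) * α) = 1 := fun m => by
      rw [hmul, Real.cos_nat_mul_two_pi]
    have hs := hsin 1
    have hc := hcos 1
    have hhalf : Real.sin (q * α / 2) = 0 := by
      have := hmul 1
      rw [mul_one, mul_one] at this
      rw [this, mul_div_assoc, mul_div_cancel_left₀ _ two_ne_zero, Real.sin_nat_mul_pi]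
    rw [mul_one] at hs hc
    refine ⟨?_, fun n _ _ => hab.aemeasurable_zeroCount_randTrigFactor q n,
      hab.one_le_liminf hs hc⟩
    filter_upwards [hab.ae_isGenericCosineSeq] with ω hω n _ hqn t ht
    obtain ⟨m, rfl⟩ := hqn
    rw [randTrigPoly_eq, randTrigFactor_eq,
      hω.trigSum_factorization hhalf hs hc (hsin m) (hcos m) ht, mul_assoc]
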